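/- Let $M$ be a pointed metric space, that is, a metric space with distance $d$ and a fixed point $0\in M$. Let $\mathrm{Lip}_0(M)$ be the Banach space of all Lipschitz functions $f\colon M\to\mathbb R$ with $f(0)=0$, with the norm $\|f\|=\sup\{|f(x)-f(y)|/d(x,y) : x,y\in M,\ x\ne y\}$. Put $\widetilde M=\{(x,y)\in M\times M : x\neq y\}$ and, for $A\subseteq M$, $\Gamma_A=\{(x,y)\in\widetilde M : x\in A \text{ or } y\in A\}$. We say that $M$ has the *function LTP* if for every bounded finitely additive measure $\mu$ with non-negative values on the power set of $\widetilde M$, every $\varepsilon\in(0,1)$, every $n\in\mathbb N$ and all $f_1,\dots,f_n\in\mathrm{Lip}_0(M)$ with $\|f_i\|\le 1$, there exist $A\subseteq M$ with $\mu(\Gamma_A)<\varepsilon$ and $u,v\in A$ with $u\ne v$ such that $$(1-\varepsilon)\bigl(f_i(x)-f_i(y)+d(u,v)\bigr)\le d(x,u)+d(y,v)\qquad\text{for all } x,y\in M\setminus A \text{ and } i\in\{1,\dots,n\}.$$ We say that $M$ has the *seq-LTP* if for every $\varepsilon>0$ there exist pairwise disjoint subsets $A_1,A_2,\dots$ of $M$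 and elements $u_m,v_m\in A_m$ with $u_m\neq v_m$ such that $$(1-\varepsilon)\bigl(d(x,y)+d(u_m,v_m)\bigr)\le d(x,u_m)+d(y,v_m)\qquad\text{for all } m\in\mathbb N \text{ and } x,y\in M\setminus A_m.$$ A slice of the closed unit ball $B_X$ of a real Banach space $X$ is a set $\{x\in B_X : x^*(x)>1-\alpha\}$ with $x^*\in X^*$, $\|x^*\|=1$ and $\alpha>0$. The space $X$ has the *strong diameter 2 property* (SD2P) if for all $n\in\mathbb N$, all $\lambda_1,\dots,\lambda_n\ge 0$ with $\sum_{i=1}^n\lambda_i=1$ and all slices $S_1,\dots,S_n$ of $B_X$, the set $\sum_{i=1}^n\lambda_iS_i$ has diameter $2$. **Theorem.** 1. If a pointed metric space $M$ has the function LTP, then $\mathrm{Lip}_0(M)$ has the SD2P. 2. The function LTP is strictly weaker than the seq-LTP: every pointed metric space with the seq-LTP has the function LTP, and there is a pointed metric space that has the function LTP but not the seq-LTP. -/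

import Mathlib

open scoped NNReal

noncomputable section

/-- The set of pairs `(x, y)` of points of `M` with `x ≠ y`, as a type. -/
abbrev OffDiag (M : Type*) : Type _ := {p : M × M // p.1 ≠ p.2}

/-- `Γ_A`: the pairs `(x, y)` with `x ≠ y` such that `x ∈ A` or `y ∈ A`. -/
def gammaSet {M : Type*} (A : Set M) : Set (OffDiag M) :=
  {p | p.1.1 ∈ A ∨ p.1.2 ∈ A}

/-- Bounded finitely additive signed measures on the power set of `E`. -/
structure BA (E : Type*) where
  toFun : Set E → ℝ
  additive : ∀ S T : Set E, Disjoint S T → toFun (S ∪ T) = toFun S + toFun T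
  bounded : ∃ C : ℝ, ∀ S : Set E, |toFun S| ≤ C

/-- The vector space of real Lipschitz functions on `M` vanishing at the base point `o`. -/
def lipSubmodule {M : Type*} [MetricSpace M] (o : M) : Submodule ℝ (M → ℝ) where
  carrier := {f | f o = 0 ∧ ∃ K : ℝ≥0, LipschitzWith K f}
  zero_mem' := ⟨rfl, 0, LipschitzWith.const 0⟩
  add_mem' := by
    rintro f g ⟨hf, K, hK⟩ ⟨hg, L, hL⟩
    exact ⟨by simp [hf, hg], K + L, hK.add hL⟩
  smul_mem' := by
    rintro c f ⟨hf, K, hK⟩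
    refine ⟨by simp [hf], ‖c‖₊ * K, LipschitzWith.of_dist_le_mul fun x y => ?_⟩
    have h := hK.dist_le_mul x y
    simp only [Pi.smul_apply, smul_eq_mul, Real.dist_eq, NNReal.coe_mul, coe_nnnorm,
      Real.norm_eq_abs, ← mul_sub, abs_mul] at h ⊢
    rw [mul_assoc]
    exact mul_le_mul_of_nonneg_left h (abs_nonneg c)

/-- `Lip₀(M)` for the metric space `M` with base point `o`. A type synonym, so that its only
topology is the one of the norm defined below. -/
def Lip0 {M : Type*} [MetricSpace M] (o : M) : Type _ := ↥(lipSubmodule o)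

namespace Lip0

variable {M : Type*} [MetricSpace M] {o : M}

instance : AddCommGroup (Lip0 o) := inferInstanceAs (AddCommGroup ↥(lipSubmodule o))

instance : Module ℝ (Lip0 o) := inferInstanceAs (Module ℝ ↥(lipSubmodule o))

instance : CoeFun (Lip0 o) (fun _ => M → ℝ) := ⟨fun f => f.1⟩

/-- `‖f‖ = sup {|f x - f y| / d(x, y) : x ≠ y}`. -/
instance : Norm (Lip0 o) :=
  ⟨fun f => ⨆ p : OffDiag M, |f p.1.1 - f p.1.2| / dist p.1.1 p.1.2⟩

theorem norm_def (f : Lip0 o) :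
    ‖f‖ = ⨆ p : OffDiag M, |f p.1.1 - f p.1.2| / dist p.1.1 p.1.2 := rfl

theorem add_apply (f g : Lip0 o) (x : M) : (f + g) x = f x + g x := rfl

theorem smul_apply (c : ℝ) (f : Lip0 o) (x : M) : (c • f) x = c * f x := rfl

theorem map_base (f : Lip0 o) : f o = 0 := f.2.1

theorem bddAbove_slopes (f : Lip0 o) :
    BddAbove (Set.range fun p : OffDiag M => |f p.1.1 - f p.1.2| / dist p.1.1 p.1.2) := by
  obtain ⟨K, hK⟩ := f.2.2
  refine ⟨K, ?_⟩
  rintro _ ⟨p, rfl⟩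
  have h := hK.dist_le_mul p.1.1 p.1.2
  rw [Real.dist_eq] at h
  exact (div_le_iff₀ (dist_pos.2 p.2)).2 h

theorem norm_nonneg' (f : Lip0 o) : 0 ≤ ‖f‖ :=
  Real.iSup_nonneg fun _ => div_nonneg (abs_nonneg _) dist_nonneg

theorem abs_sub_le (f : Lip0 o) (x y : M) : |f x - f y| ≤ ‖f‖ * dist x y := by
  by_cases h : x = y
  · simp [h]
  · exact (div_le_iff₀ (dist_pos.2 h)).1 (le_ciSup (bddAbove_slopes f) ⟨(x, y), h⟩)

theorem norm_le_of {f : Lip0 o} {C : ℝ} (hC : 0 ≤ C)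
    (h : ∀ x y, |f x - f y| ≤ C * dist x y) : ‖f‖ ≤ C :=
  Real.iSup_le (fun p => (div_le_iff₀ (dist_pos.2 p.2)).2 (h _ _)) hC

theorem norm_smul_le' (c : ℝ) (f : Lip0 o) : ‖c • f‖ ≤ ‖c‖ * ‖f‖ := by
  refine norm_le_of (mul_nonneg (norm_nonneg c) (norm_nonneg' f)) fun x y => ?_
  rw [smul_apply, smul_apply, ← mul_sub, abs_mul, mul_assoc, Real.norm_eq_abs]
  exact mul_le_mul_of_nonneg_left (abs_sub_le f x y) (abs_nonneg c)

theorem core : NormedSpace.Core ℝ (Lip0 o) where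
  norm_nonneg := norm_nonneg'
  norm_smul c f := by
    refine le_antisymm (norm_smul_le' c f) ?_
    rcases eq_or_ne c 0 with rfl | hc
    · simpa using norm_nonneg' (0 : Lip0 o)
    · have h := norm_smul_le' c⁻¹ (c • f)
      rw [inv_smul_smul₀ hc, norm_inv] at h
      have hc' : 0 < ‖c‖ := norm_pos_iff.2 hc
      calc ‖c‖ * ‖f‖ ≤ ‖c‖ * (‖c‖⁻¹ * ‖c • f‖) := mul_le_mul_of_nonneg_left h hc'.le
        _ = ‖c • f‖ := by field_simp
  norm_triangle f g := by
    refine norm_le_of (add_nonneg (norm_nonneg' f) (norm_nonneg' g)) fun x y => ?_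
    have h : (f + g) x - (f + g) y = (f x - f y) + (g x - g y) := by
      rw [add_apply, add_apply]; ring
    rw [h, add_mul]
    exact (abs_add_le _ _).trans (add_le_add (abs_sub_le f x y) (abs_sub_le g x y))
  norm_eq_zero_iff f := by
    constructor
    · intro h
      refine Subtype.ext (funext fun x => ?_)
      have hx := abs_sub_le f x o
      rw [h, zero_mul, map_base, sub_zero] at hx
      exact abs_nonpos_iff.1 hx
    · rintro rfl
      refine le_antisymm (norm_le_of le_rfl fun x y => ?_) (norm_nonneg' _)
      have h0 : ∀ z : M, (0 : Lip0 o) z = 0 := fun _ => rfl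
      simp [h0]

instance : NormedAddCommGroup (Lip0 o) := NormedAddCommGroup.ofCore core

instance : NormedSpace ℝ (Lip0 o) := NormedSpace.ofCore core

end Lip0

/-- The subset `{x ∈ B_X : φ x > 1 - α}` of the closed unit ball of `X`; it is a slice when
`‖φ‖ = 1` and `α > 0`. -/
def slice {X : Type*} [NormedAddCommGroup X] [NormedSpace ℝ X] (φ : X →L[ℝ] ℝ) (α : ℝ) : Set X :=
  {x | ‖x‖ ≤ 1 ∧ 1 - α < φ x}

/-- The strong diameter 2 property: every convex combination of slices of the closed unit ball
has diameter 2. -/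
def StrongDiameterTwo (X : Type*) [NormedAddCommGroup X] [NormedSpace ℝ X] : Prop :=
  ∀ (n : ℕ) (w : Fin n → ℝ) (φ : Fin n → X →L[ℝ] ℝ) (α : Fin n → ℝ),
    (∀ i, 0 ≤ w i) → ∑ i, w i = 1 → (∀ i, ‖φ i‖ = 1) → (∀ i, 0 < α i) →
    Metric.diam {x : X | ∃ y : Fin n → X, (∀ i, y i ∈ slice (φ i) (α i)) ∧
      x = ∑ i, w i • y i} = 2

/-- The function LTP of the metric space `M` with base point `o`. Here `ε` ranges over `(0, 1)`:
the condition is about small `ε`, and for `ε > 1` the factor `1 - ε` would reverse the meaning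
of the inequality. -/
def FunctionLTP {M : Type*} [MetricSpace M] (o : M) : Prop :=
  ∀ μ : BA (OffDiag M), (∀ S, 0 ≤ μ.toFun S) →
    ∀ ε : ℝ, 0 < ε → ε < 1 →
    ∀ (n : ℕ) (f : Fin n → Lip0 o), (∀ i, ‖f i‖ ≤ 1) →
    ∃ (A : Set M) (u v : M), μ.toFun (gammaSet A) < ε ∧ u ∈ A ∧ v ∈ A ∧ u ≠ v ∧
      ∀ x y : M, x ∉ A → y ∉ A → ∀ i,
        (1 - ε) * (f i x - f i y + dist u v) ≤ dist x u + dist y v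

/-- The seq-LTP. -/
def SeqLTP (M : Type*) [MetricSpace M] : Prop :=
  ∀ ε : ℝ, 0 < ε →
    ∃ (A : ℕ → Set M) (u v : ℕ → M), (∀ k m, k ≠ m → Disjoint (A k) (A m)) ∧
      (∀ m, u m ∈ A m ∧ v m ∈ A m ∧ u m ≠ v m) ∧
      ∀ (m : ℕ) (x y : M), x ∉ A m → y ∉ A m →
        (1 - ε) * (dist x y + dist (u m) (v m)) ≤ dist x (u m) + dist y (v m)

end

/-! SD2P: the de Leeuw embedding sends a function to its slopes in `ℓ^∞`. By Hahn–Banach each slice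
functional extends to `ℓ^∞`, and its variation is a finitely additive measure. So a bounded function
that is constant off `A` has small value when `Γ_A` has small measure (`Lip0.exists_measure`). Take
nearly norming `f i` and apply the function LTP to the sum of the measures and to all `±f i`. One
pair `u`, `v` then serves every `i`: each `f i`, shrunk slightly, can be altered on `A` to have
slope nearly `1` or nearly `-1` along it (`Lip0.exists_eq_off_of_le`). Both versions stay in the
slice, and averaging keeps slopes that are common to all `i`.

The seq-LTP gives the function LTP because, among disjoint sets `A m`, some `Γ_{A m}` has small
measure. For the converse, the half graph separates the two: a single 1-Lipschitz function sees its
distances `2` only from finitely many `inl` points, whereas the metric itself forces each admissible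
`A` to be too large for infinitely many disjoint copies. -/

open Filter Topology

/-! ### Finitely additive measures -/

namespace BA

variable {E : Type*}

theorem mono (μ : BA E) (hμ : ∀ S, 0 ≤ μ.toFun S) {S T : Set E} (h : S ⊆ T) :
    μ.toFun S ≤ μ.toFun T := by
  have h1 := μ.additive S (T \ S) Set.disjoint_sdiff_right
  rw [Set.union_sdiff_cancel h] at h1
  linarith [hμ (T \ S)]

theorem union_le (μ : BA E) (hμ : ∀ S, 0 ≤ μ.toFun S) (S T : Set E) :
    μ.toFun (S ∪ T) ≤ μ.toFun S + μ.toFun T := by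
  have h1 := μ.additive S (T \ S) Set.disjoint_sdiff_right
  rw [Set.union_sdiff_self] at h1
  linarith [μ.mono hμ (Set.sdiff_subset : T \ S ⊆ T)]

theorem sum_le_univ (μ : BA E) (hμ : ∀ S, 0 ≤ μ.toFun S) (B : ℕ → Set E)
    (hB : ∀ k m, k ≠ m → Disjoint (B k) (B m)) (N : ℕ) :
    ∑ m ∈ Finset.range N, μ.toFun (B m) ≤ μ.toFun Set.univ := by
  suffices h : ∑ m ∈ Finset.range N, μ.toFun (B m) ≤ μ.toFun (⋃ m ∈ Finset.range N, B m) from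
    h.trans (μ.mono hμ (Set.subset_univ _))
  induction N with
  | zero => simpa using hμ _
  | succ N ih =>
    have hd : Disjoint (⋃ m ∈ Finset.range N, B m) (B N) := by
      simp only [Set.disjoint_iUnion_left, Finset.mem_range]
      exact fun m hm => hB _ _ hm.ne
    have h1 := μ.additive _ _ hd
    have h2 : (⋃ m ∈ Finset.range (N + 1), B m) = (⋃ m ∈ Finset.range N, B m) ∪ B N := by
      rw [Finset.range_add_one, Finset.set_biUnion_insert, Set.union_comm]
    rw [Finset.sum_range_succ, h2, h1]
    linarith

/-- The sets `Γ_{A m}` may overlap, but each is covered by its two coordinate parts, and each kind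
of part is disjoint over `m`. Hence the measures of the `Γ_{A m}` have partial sums at most twice
the total mass. -/
theorem exists_gammaSet_lt {M : Type*} (μ : BA (OffDiag M)) (hμ : ∀ S, 0 ≤ μ.toFun S)
    (A : ℕ → Set M) (hA : ∀ k m, k ≠ m → Disjoint (A k) (A m)) {ε : ℝ} (hε : 0 < ε) :
    ∃ m, μ.toFun (gammaSet (A m)) < ε := by
  by_contra! h
  obtain ⟨N, hN⟩ := exists_nat_gt (2 * μ.toFun Set.univ / ε)
  rw [div_lt_iff₀ hε] at hN
  let X : ℕ → Set (OffDiag M) := fun m => {p | p.1.1 ∈ A m}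
  let Y : ℕ → Set (OffDiag M) := fun m => {p | p.1.2 ∈ A m}
  have hX := μ.sum_le_univ hμ X
    (fun k m hkm => Set.disjoint_left.2 fun _ hp => Set.disjoint_left.1 (hA k m hkm) hp) N
  have hY := μ.sum_le_univ hμ Y
    (fun k m hkm => Set.disjoint_left.2 fun _ hp => Set.disjoint_left.1 (hA k m hkm) hp) N
  have h1 : ∑ m ∈ Finset.range N, ε
      ≤ ∑ m ∈ Finset.range N, (μ.toFun (X m) + μ.toFun (Y m)) :=
    Finset.sum_le_sum fun m _ => (h m).trans (μ.union_le hμ (X m) (Y m))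
  rw [Finset.sum_add_distrib, Finset.sum_const, Finset.card_range, nsmul_eq_mul] at h1
  linarith

/-- Finite sums of finitely additive measures. -/
def sum {n : ℕ} (μ : Fin n → BA E) : BA E where
  toFun S := ∑ i, (μ i).toFun S
  additive S T h := by
    rw [← Finset.sum_add_distrib]
    exact Finset.sum_congr rfl fun i _ => (μ i).additive S T h
  bounded := by
    choose C hC using fun i => (μ i).bounded
    exact ⟨∑ i, C i, fun S =>
      (Finset.abs_sum_le_sum_abs _ _).trans (Finset.sum_le_sum fun i _ => hC i S)⟩

end BA

/-! ### The variation of a functional on `ℓ^∞` -/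

section Variation

open scoped ENNReal

variable {E : Type*}

theorem exists_lp_infty_of_abs_le (g : E → ℝ) {C : ℝ} (hC : 0 ≤ C) (h : ∀ p, |g p| ≤ C) :
    ∃ k : lp (fun _ : E => ℝ) ∞, (∀ p, k p = g p) ∧ ‖k‖ ≤ C := by
  have hm : Memℓp (E := fun _ : E => ℝ) g ∞ :=
    memℓp_infty ⟨C, by rintro _ ⟨p, rfl⟩; exact h p⟩
  exact ⟨⟨g, hm⟩, fun p => rfl, lp.norm_le_of_forall_le hC h⟩

/-- The values of `ψ` on the elements of the unit ball of `ℓ^∞` supported in `S`. -/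
def supportedValues (ψ : lp (fun _ : E => ℝ) ∞ →L[ℝ] ℝ) (S : Set E) : Set ℝ :=
  {r | ∃ h : lp (fun _ : E => ℝ) ∞, ‖h‖ ≤ 1 ∧ (∀ p, p ∉ S → h p = 0) ∧ ψ h = r}

variable (ψ : lp (fun _ : E => ℝ) ∞ →L[ℝ] ℝ)

theorem le_norm_of_mem_supportedValues {S : Set E} {r : ℝ} (hr : r ∈ supportedValues ψ S) :
    r ≤ ‖ψ‖ := by
  obtain ⟨h, h1, -, rfl⟩ := hr
  calc ψ h ≤ ‖ψ h‖ := le_abs_self _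
    _ ≤ ‖ψ‖ * ‖h‖ := ψ.le_opNorm h
    _ ≤ ‖ψ‖ * 1 := by gcongr
    _ = ‖ψ‖ := mul_one _

theorem bddAbove_supportedValues (S : Set E) : BddAbove (supportedValues ψ S) :=
  ⟨‖ψ‖, fun _ => le_norm_of_mem_supportedValues ψ⟩

theorem zero_mem_supportedValues (S : Set E) : (0 : ℝ) ∈ supportedValues ψ S :=
  ⟨0, by simp, fun _ _ => rfl, map_zero ψ⟩

theorem sSup_supportedValues_nonneg (S : Set E) : 0 ≤ sSup (supportedValues ψ S) :=
  le_csSup (bddAbove_supportedValues ψ S) (zero_mem_supportedValues ψ S)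

/-- Functions on `S ∪ T` split by restriction. Conversely, in the sup norm the sum of two disjointly
supported elements of the unit ball stays in the ball. -/
theorem sSup_supportedValues_union (S T : Set E) (hST : Disjoint S T) :
    sSup (supportedValues ψ (S ∪ T))
      = sSup (supportedValues ψ S) + sSup (supportedValues ψ T) := by
  classical
  refine le_antisymm (csSup_le ⟨0, zero_mem_supportedValues ψ _⟩ ?_) ?_
  · rintro _ ⟨h, h1, h0, rfl⟩
    have hh : ∀ p, |h p| ≤ 1 := fun p => (lp.norm_apply_le_norm (by simp) h p).trans h1
    obtain ⟨a, ha, ha1⟩ := exists_lp_infty_of_abs_le (fun p => if p ∈ S then h p else 0)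
      zero_le_one (fun p => by split_ifs <;> simp [hh])
    obtain ⟨b, hb, hb1⟩ := exists_lp_infty_of_abs_le (fun p => if p ∈ S then 0 else h p)
      zero_le_one (fun p => by split_ifs <;> simp [hh])
    have hab : h = a + b := by
      ext p
      rw [lp.coeFn_add, Pi.add_apply, ha, hb]
      split_ifs <;> simp
    rw [hab, map_add]
    refine add_le_add (le_csSup (bddAbove_supportedValues ψ S) ⟨a, ha1, fun p hp => ?_, rfl⟩)
      (le_csSup (bddAbove_supportedValues ψ T) ⟨b, hb1, fun p hp => ?_, rfl⟩)
    · rw [ha, if_neg hp]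
    · rw [hb]
      split_ifs with hS
      · rfl
      · exact h0 p (by simp [hS, hp])
  · rw [← le_sub_iff_add_le]
    refine csSup_le ⟨0, zero_mem_supportedValues ψ _⟩ ?_
    rintro _ ⟨a, ha1, ha0, rfl⟩
    rw [le_sub_comm]
    refine csSup_le ⟨0, zero_mem_supportedValues ψ _⟩ ?_
    rintro _ ⟨b, hb1, hb0, rfl⟩
    rw [le_sub_iff_add_le', ← map_add]
    refine le_csSup (bddAbove_supportedValues ψ _) ⟨a + b, ?_, fun p hp => ?_, rfl⟩
    · refine lp.norm_le_of_forall_le zero_le_one fun p => ?_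
      rw [lp.coeFn_add, Pi.add_apply]
      by_cases hp : p ∈ S
      · rw [hb0 p (Set.disjoint_left.1 hST hp), add_zero]
        exact (lp.norm_apply_le_norm (by simp) a p).trans ha1
      · rw [ha0 p hp, zero_add]
        exact (lp.norm_apply_le_norm (by simp) b p).trans hb1
    · rw [Set.mem_union, not_or] at hp
      rw [lp.coeFn_add, Pi.add_apply, ha0 p hp.1, hb0 p hp.2, add_zero]

/-- The total variation of the finitely additive measure representing `ψ`. -/
noncomputable def variation : BA E where
  toFun S := sSup (supportedValues ψ S)
  additive := sSup_supportedValues_union ψ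
  bounded := ⟨‖ψ‖, fun S => by
    rw [abs_of_nonneg (sSup_supportedValues_nonneg ψ S)]
    exact csSup_le ⟨0, zero_mem_supportedValues ψ _⟩
      fun _ => le_norm_of_mem_supportedValues ψ⟩

theorem apply_le_variation {S : Set E} (h : lp (fun _ : E => ℝ) ∞) {C : ℝ} (hC : 0 < C)
    (h1 : ‖h‖ ≤ C) (h0 : ∀ p, p ∉ S → h p = 0) : ψ h ≤ C * (variation ψ).toFun S := by
  have hm : ψ (C⁻¹ • h) ≤ (variation ψ).toFun S := by
    refine le_csSup (bddAbove_supportedValues ψ S) ⟨_, ?_, fun p hp => ?_, rfl⟩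
    · rw [norm_smul, norm_inv, Real.norm_of_nonneg hC.le, inv_mul_le_iff₀ hC, mul_one]
      exact h1
    · rw [lp.coeFn_smul, Pi.smul_apply, h0 p hp, smul_zero]
  rwa [map_smul, smul_eq_mul, inv_mul_le_iff₀ hC] at hm

end Variation

/-! ### The de Leeuw embedding and the strong diameter 2 property -/

namespace Lip0

open scoped ENNReal

variable {M : Type*} [MetricSpace M] {o : M}

theorem neg_apply (f : Lip0 o) (x : M) : (-f) x = -f x := rfl

theorem sub_apply (f g : Lip0 o) (x : M) : (f - g) x = f x - g x := rfl

theorem abs_slope_le (f : Lip0 o) (p : OffDiag M) :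
    |(f p.1.1 - f p.1.2) / dist p.1.1 p.1.2| ≤ ‖f‖ := by
  rw [abs_div, abs_of_nonneg (dist_nonneg : 0 ≤ dist p.1.1 p.1.2)]
  exact (div_le_iff₀ (dist_pos.2 p.2)).2 (abs_sub_le f _ _)

/-- The de Leeuw embedding of `Lip₀(M)` into `ℓ^∞`. -/
noncomputable def slopes (o : M) : Lip0 o →ₗᵢ[ℝ] lp (fun _ : OffDiag M => ℝ) ∞ where
  toFun f := ⟨fun p => (f p.1.1 - f p.1.2) / dist p.1.1 p.1.2,
    memℓp_infty ⟨‖f‖, by rintro _ ⟨p, rfl⟩; exact abs_slope_le f p⟩⟩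
  map_add' f g := by
    ext p
    rw [lp.coeFn_add, Pi.add_apply]
    simp only [add_apply]
    ring
  map_smul' c f := by
    ext p
    rw [lp.coeFn_smul, Pi.smul_apply]
    simp only [smul_apply, RingHom.id_apply, smul_eq_mul]
    ring
  norm_map' f := by
    refine le_antisymm (lp.norm_le_of_forall_le (norm_nonneg f) (abs_slope_le f)) ?_
    refine Real.iSup_le (fun p => ?_) (norm_nonneg _)
    refine le_trans (le_of_eq ?_) (lp.norm_apply_le_norm (by simp) _ p)
    simp

theorem slopes_apply (f : Lip0 o) (p : OffDiag M) :
    slopes o f p = (f p.1.1 - f p.1.2) / dist p.1.1 p.1.2 := rfl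

theorem exists_extension (φ : Lip0 o →L[ℝ] ℝ) :
    ∃ ψ : lp (fun _ : OffDiag M => ℝ) ∞ →L[ℝ] ℝ, ∀ f, ψ (slopes o f) = φ f := by
  let e := (slopes o).equivRange
  obtain ⟨ψ, hψ, -⟩ := exists_extension_norm_eq (LinearMap.range (slopes o).toLinearMap)
    (φ.comp (e.symm.toContinuousLinearEquiv : _ →L[ℝ] Lip0 o))
  refine ⟨ψ, fun f => ?_⟩
  have h := hψ (e f)
  have h2 : ((e f : LinearMap.range (slopes o).toLinearMap) : lp (fun _ : OffDiag M => ℝ) ∞)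
      = slopes o f := rfl
  rw [h2] at h
  rw [h]
  simp

/-- A functional on `Lip₀(M)` is controlled by a finitely additive measure `μ`: on functions that
are constant off `A` it is at most the norm times `μ(Γ_A)`. -/
theorem exists_measure (φ : Lip0 o →L[ℝ] ℝ) :
    ∃ μ : BA (OffDiag M), (∀ S, 0 ≤ μ.toFun S) ∧ ∀ (A : Set M) (f : Lip0 o) (C : ℝ), 0 < C →
      ‖f‖ ≤ C → (∀ x y, x ∉ A → y ∉ A → f x = f y) → φ f ≤ C * μ.toFun (gammaSet A) := by
  obtain ⟨ψ, hψ⟩ := exists_extension φ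
  refine ⟨variation ψ, sSup_supportedValues_nonneg ψ, fun A f C hC hf h0 => ?_⟩
  rw [← hψ]
  refine apply_le_variation ψ _ hC (by rwa [LinearIsometry.norm_map]) fun p hp => ?_
  have hp' : p.1.1 ∉ A ∧ p.1.2 ∉ A := not_or.1 hp
  rw [slopes_apply, h0 _ _ hp'.1 hp'.2, sub_self, zero_div]

/-- Keep `c * f` off `A` and seek the value `b` at `v`, with `b + c * dist u v` at `u`. Each `x ∉ A`
confines `b` to two intervals, and intervals on a line with pairwise common points have a common
point. The hypothesis `h` is exactly the one comparison that the triangle inequality does not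
supply. -/
theorem exists_eq_off_of_le (A : Set M) {u v : M} (hu : u ∈ A) (hv : v ∈ A) (huv : u ≠ v) {c : ℝ}
    (hc0 : 0 ≤ c) (hc1 : c ≤ 1) (f : Lip0 o) (hf : ‖f‖ ≤ 1)
    (h : ∀ x y, x ∉ A → y ∉ A → c * (f x - f y + dist u v) ≤ dist x v + dist y u) :
    ∃ g : Lip0 o, ‖g‖ ≤ 1 ∧ g u - g v = c * dist u v ∧
      ∀ x y, x ∉ A → y ∉ A → g x - g y = c * (f x - f y) := by
  classical
  have hfd : ∀ x y, c * (f x - f y) ≤ c * dist x y := fun x y => by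
    refine mul_le_mul_of_nonneg_left ?_ hc0
    calc f x - f y ≤ ‖f‖ * dist x y := (le_abs_self _).trans (abs_sub_le f x y)
      _ ≤ 1 * dist x y := by gcongr
      _ = dist x y := one_mul _
  have hcd : ∀ x y : M, c * dist x y ≤ dist x y := fun x y =>
    mul_le_of_le_one_left dist_nonneg hc1
  have hb : ∃ b : ℝ, ∀ x, x ∉ A → c * f x - dist x v ≤ b ∧ b ≤ c * f x + dist x v ∧
      c * f x - c * dist u v - dist x u ≤ b ∧ b ≤ c * f x - c * dist u v + dist x u := by
    by_cases hA : ∃ z, z ∉ A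
    · obtain ⟨z, hz⟩ := hA
      let L : M → ℝ := fun x => max (c * f x - dist x v) (c * f x - c * dist u v - dist x u)
      let U : M → ℝ := fun x => min (c * f x + dist x v) (c * f x - c * dist u v + dist x u)
      obtain ⟨b, hb1, hb2⟩ := exists_between_of_forall_le (s := L '' Aᶜ) (t := U '' Aᶜ)
        ⟨_, z, hz, rfl⟩ ⟨_, z, hz, rfl⟩ (by
          rintro _ ⟨x, hx, rfl⟩ _ ⟨y, hy, rfl⟩
          have e1 := hfd x y
          have e2 := hcd x y
          have e3 := dist_triangle_right x y v
          have e4 := dist_triangle_right x y u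
          have e5 := h x y hx hy
          have e6 : c * dist x y ≤ dist x u + c * dist u v + dist y v := by
            have t := mul_le_mul_of_nonneg_left (dist_triangle4 x u v y) hc0
            have t1 := hcd x u
            have t2 := hcd v y
            rw [dist_comm v y] at t2 t
            linarith
          refine max_le (le_min ?_ ?_) (le_min ?_ ?_) <;> linarith)
      refine ⟨b, fun x hx => ?_⟩
      have l := max_le_iff.1 (hb1 ⟨x, hx, rfl⟩ : L x ≤ b)
      have l' := le_min_iff.1 (hb2 ⟨x, hx, rfl⟩ : b ≤ U x)
      exact ⟨l.1, l'.1, l.2, l'.2⟩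
    · exact ⟨0, fun x hx => absurd ⟨x, hx⟩ hA⟩
  obtain ⟨b, hb⟩ := hb
  let G : M → ℝ := fun z => if z = u then b + c * dist u v else if z = v then b else c * f z
  have Gu : G u = b + c * dist u v := if_pos rfl
  have Gv : G v = b := by simp [G, huv.symm]
  have GA : ∀ x, x ∉ A → G x = c * f x := fun x hx => by
    have h1 : x ≠ u := fun h => hx (h ▸ hu)
    have h2 : x ≠ v := fun h => hx (h ▸ hv)
    simp [G, h1, h2]
  have key : LipschitzOnWith 1 G (Aᶜ ∪ {u, v}) := by
    refine LipschitzOnWith.of_le_add_mul 1 ?_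
    rw [NNReal.coe_one]
    have duv := hcd u v
    have duv0 : 0 ≤ c * dist u v := mul_nonneg hc0 dist_nonneg
    rintro x (hx | rfl | rfl) y (hy | rfl | rfl)
    · rw [GA x hx, GA y hy]; linarith [hfd x y, hcd x y]
    · rw [GA x hx, Gu]; linarith [hb x hx]
    · rw [GA x hx, Gv]; linarith [hb x hx]
    · rw [GA y hy, Gu, dist_comm x y]; linarith [hb y hy]
    · simp
    · rw [Gu, Gv]; linarith
    · rw [GA y hy, Gv, dist_comm x y]; linarith [hb y hy]
    · rw [Gu, Gv, dist_comm x y]; linarith [dist_nonneg (x := y) (y := x)]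
    · simp
  obtain ⟨k, hk, hkG⟩ := key.extend_real
  -- The base point may lie in `A`, so the extension is renormalised at `o`; only differences
  -- survive.
  have hk' : LipschitzWith 1 fun x => k x - k o := LipschitzWith.of_dist_le_mul fun x y => by
    simpa [Real.dist_eq] using hk.dist_le_mul x y
  refine ⟨⟨fun x => k x - k o, sub_self _, 1, hk'⟩, norm_le_of zero_le_one fun x y => ?_, ?_, ?_⟩
  · simpa [Real.dist_eq] using hk'.dist_le_mul x y
  · change k u - k o - (k v - k o) = _
    rw [← hkG (by simp : u ∈ Aᶜ ∪ {u, v}), ← hkG (by simp : v ∈ Aᶜ ∪ {u, v}), Gu, Gv]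
    ring
  · intro x y hx hy
    change k x - k o - (k y - k o) = _
    rw [← hkG (by simp [hx] : x ∈ Aᶜ ∪ {u, v}), ← hkG (by simp [hy] : y ∈ Aᶜ ∪ {u, v}), GA x hx,
      GA y hy]
    ring

/-- The functional `f ↦ f u - f v`. -/
def evalSub (o u v : M) : Lip0 o →ₗ[ℝ] ℝ where
  toFun f := f u - f v
  map_add' f g := by simp only [add_apply]; ring
  map_smul' c f := by simp only [smul_apply, RingHom.id_apply, smul_eq_mul]; ring

theorem evalSub_apply (u v : M) (f : Lip0 o) : evalSub o u v f = f u - f v := rfl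

end Lip0

theorem exists_norm_le_one_lt_apply {X : Type*} [NormedAddCommGroup X] [NormedSpace ℝ X]
    (φ : X →L[ℝ] ℝ) (hφ : ‖φ‖ = 1) {r : ℝ} (hr : r < 1) : ∃ x, ‖x‖ ≤ 1 ∧ r < φ x := by
  obtain ⟨x, hx, hx'⟩ := φ.exists_lt_apply_of_lt_opNorm (hφ ▸ hr)
  rcases le_total 0 (φ x) with h | h
  · exact ⟨x, hx.le, by rwa [Real.norm_of_nonneg h] at hx'⟩
  · exact ⟨-x, by rw [norm_neg]; exact hx.le,
      by rwa [Real.norm_of_nonpos h, ← map_neg] at hx'⟩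

/-- It suffices to find two points of the combination of slices whose difference has slope `2 * (1 -
ε)` along one pair. -/
theorem strongDiameterTwo_of_functionLTP {M : Type*} [MetricSpace M] {o : M}
    (hM : FunctionLTP o) : StrongDiameterTwo (Lip0 o) := by
  intro n w φ α hw hw1 hφ hα
  set D : Set (Lip0 o) :=
    {x | ∃ y : Fin n → Lip0 o, (∀ i, y i ∈ slice (φ i) (α i)) ∧ x = ∑ i, w i • y i} with hD
  have hball : ∀ x ∈ D, ‖x‖ ≤ 1 := by
    rintro x ⟨y, hy, rfl⟩
    calc ‖∑ i, w i • y i‖ ≤ ∑ i, ‖w i • y i‖ := norm_sum_le _ _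
      _ ≤ ∑ i, w i := Finset.sum_le_sum fun i _ => by
        rw [norm_smul, Real.norm_of_nonneg (hw i)]
        exact mul_le_of_le_one_right (hw i) (hy i).1
      _ = 1 := hw1
  have hdist : ∀ x ∈ D, ∀ y ∈ D, dist x y ≤ 2 := fun x hx y hy => by
    rw [dist_eq_norm]
    linarith [norm_sub_le x y, hball x hx, hball y hy]
  refine le_antisymm (Metric.diam_le_of_forall_dist_le zero_le_two hdist) ?_
  have hbdd : Bornology.IsBounded D := Metric.isBounded_iff.2 ⟨2, fun x hx y hy => hdist x hx y hy⟩
  refine le_of_forall_pos_le_add fun δ hδ => ?_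
  -- Altering `f i` leaves a value above `(1 - ε)^2 - 2 * ε`, which is at least `1 - 4 * ε`.
  obtain ⟨ε, hεα, hε0, hε1, hεδ⟩ : ∃ ε : ℝ, (∀ i, 4 * ε < α i) ∧ 0 < ε ∧ ε < 1 ∧ 2 * ε < δ := by
    have hall : ∀ r : ℝ, 0 < r → ∀ᶠ ε in 𝓝[>] (0 : ℝ), ε < r := fun r hr =>
      mem_of_superset (Ioo_mem_nhdsGT hr) fun x hx => hx.2
    have h1 : ∀ᶠ ε in 𝓝[>] (0 : ℝ), ∀ i, ε < α i / 4 :=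
      eventually_all.2 fun i => hall _ (by linarith [hα i])
    obtain ⟨ε, ⟨⟨⟨h1, h2⟩, h3⟩, h4⟩⟩ := (((h1.and (self_mem_nhdsWithin :
      ∀ᶠ ε in 𝓝[>] (0 : ℝ), 0 < ε)).and (hall 1 one_pos)).and (hall (δ / 2) (by linarith))).exists
    exact ⟨ε, fun i => by linarith [h1 i], h2, h3, by linarith⟩
  choose f hf hφf using fun i =>
    exists_norm_le_one_lt_apply (φ i) (hφ i) (show 1 - ε < 1 by linarith)
  choose μ hμ0 hμ using fun i => Lip0.exists_measure (φ i)
  obtain ⟨A, u, v, hA, hu, hv, huv, hLTP⟩ := hM (BA.sum μ)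
    (fun S => Finset.sum_nonneg (s := Finset.univ) fun i _ => hμ0 i S) ε hε0 hε1 (n + n)
    (Fin.append f fun i => -f i) (by
      intro i
      refine Fin.addCases (fun i => ?_) (fun i => ?_) i
      · rw [Fin.append_left]; exact hf i
      · rw [Fin.append_right, norm_neg]; exact hf i)
  have hpos : ∀ i x y, x ∉ A → y ∉ A →
      (1 - ε) * (f i x - f i y + dist v u) ≤ dist x u + dist y v := fun i x y hx hy => by
    have := hLTP x y hx hy (Fin.castAdd n i)
    rwa [Fin.append_left, dist_comm u v] at this
  -- The inequality for `-f i` with `x` and `y` exchanged is the one for `f i` with `u` and `v`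
  -- exchanged.
  have hneg : ∀ i x y, x ∉ A → y ∉ A →
      (1 - ε) * (f i x - f i y + dist u v) ≤ dist x v + dist y u := fun i x y hx hy => by
    have := hLTP y x hy hx (Fin.natAdd n i)
    rw [Fin.append_right, Lip0.neg_apply, Lip0.neg_apply, neg_sub_neg] at this
    linarith
  have hAi : ∀ i, (μ i).toFun (gammaSet A) < ε := fun i =>
    (Finset.single_le_sum (f := fun i => (μ i).toFun (gammaSet A)) (fun i _ => hμ0 i _)
      (Finset.mem_univ i)).trans_lt hA
  have hslice : ∀ i (g : Lip0 o), ‖g‖ ≤ 1 →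
      (∀ x y, x ∉ A → y ∉ A → g x - g y = (1 - ε) * (f i x - f i y)) →
      g ∈ slice (φ i) (α i) := by
    intro i g hg hgf
    refine ⟨hg, ?_⟩
    have h1 : φ i ((1 - ε) • f i - g) ≤ 2 * (μ i).toFun (gammaSet A) := by
      refine hμ i A _ 2 two_pos ?_ fun x y hx hy => ?_
      · have h2 : ‖(1 - ε) • f i‖ ≤ 1 := by
          rw [norm_smul, Real.norm_of_nonneg (by linarith)]
          nlinarith [hf i, norm_nonneg (f i)]
        linarith [norm_sub_le ((1 - ε) • f i) g]
      · simp only [Lip0.sub_apply, Lip0.smul_apply]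
        linarith [hgf x y hx hy]
    rw [map_sub, map_smul, smul_eq_mul] at h1
    have h3 : (1 - ε) * (1 - ε) ≤ (1 - ε) * φ i (f i) :=
      mul_le_mul_of_nonneg_left (hφf i).le (by linarith)
    nlinarith [hAi i, hεα i, sq_nonneg ε]
  choose g hg1 hguv hgA using fun i =>
    Lip0.exists_eq_off_of_le A hu hv huv (by linarith) (by linarith) (f i) (hf i) (hneg i)
  choose k hk1 hkuv hkA using fun i =>
    Lip0.exists_eq_off_of_le A hv hu huv.symm (by linarith) (by linarith) (f i) (hf i) (hpos i)
  have hgD : ∑ i, w i • g i ∈ D := ⟨g, fun i => hslice i _ (hg1 i) (hgA i), rfl⟩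
  have hkD : ∑ i, w i • k i ∈ D := ⟨k, fun i => hslice i _ (hk1 i) (hkA i), rfl⟩
  have hev : Lip0.evalSub o u v (∑ i, w i • g i - ∑ i, w i • k i)
      = 2 * (1 - ε) * dist u v := by
    rw [map_sub, map_sum, map_sum, ← Finset.sum_sub_distrib]
    calc ∑ i, (Lip0.evalSub o u v (w i • g i) - Lip0.evalSub o u v (w i • k i))
        = ∑ i, w i * (2 * (1 - ε) * dist u v) := Finset.sum_congr rfl fun i _ => by
          have h2 := hkuv i
          rw [dist_comm v u] at h2
          rw [map_smul, map_smul, Lip0.evalSub_apply, Lip0.evalSub_apply, smul_eq_mul,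
            smul_eq_mul, hguv i, ← neg_sub (k i v), h2]
          ring
      _ = 2 * (1 - ε) * dist u v := by rw [← Finset.sum_mul, hw1, one_mul]
  have hle : 2 * (1 - ε) * dist u v ≤ dist (∑ i, w i • g i) (∑ i, w i • k i) * dist u v := by
    rw [← hev, Lip0.evalSub_apply, dist_eq_norm]
    exact (le_abs_self _).trans (Lip0.abs_sub_le _ u v)
  have := le_of_mul_le_mul_right hle (dist_pos.2 huv)
  linarith [Metric.dist_le_diam_of_mem hbdd hgD hkD]

theorem Lip0.sub_le_dist {M : Type*} [MetricSpace M] {o : M} {f : Lip0 o} (hf : ‖f‖ ≤ 1)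
    (x y : M) : f x - f y ≤ dist x y :=
  ((le_abs_self _).trans (Lip0.abs_sub_le f x y)).trans
    (mul_le_of_le_one_left dist_nonneg hf)

theorem functionLTP_of_seqLTP {M : Type*} [MetricSpace M] (o : M) (hM : SeqLTP M) :
    FunctionLTP o := by
  intro μ hμ ε hε0 hε1 n f hf
  obtain ⟨A, u, v, hA, huv, h⟩ := hM ε hε0
  obtain ⟨m, hm⟩ := μ.exists_gammaSet_lt hμ A hA hε0
  refine ⟨A m, u m, v m, hm, (huv m).1, (huv m).2.1, (huv m).2.2, fun x y hx hy i => ?_⟩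
  refine le_trans (mul_le_mul_of_nonneg_left ?_ (by linarith)) (h m x y hx hy)
  linarith [Lip0.sub_le_dist (hf i) x y]

/-! ### The half graph metric -/

/-- The metric space on two copies of `ℕ` in which the points `inl i` and `inr k` are at
distance `2` for `i < k`, and all other distances between distinct points are `1`. -/
structure HalfGraph where
  val : ℕ ⊕ ℕ

namespace HalfGraph

/-- The points of the first copy of `ℕ`. -/
abbrev l (i : ℕ) : HalfGraph := ⟨Sum.inl i⟩

/-- The points of the second copy of `ℕ`. -/
abbrev r (k : ℕ) : HalfGraph := ⟨Sum.inr k⟩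

/-- The distance of the half graph. -/
def halfDist : HalfGraph → HalfGraph → ℝ
  | ⟨.inl i⟩, ⟨.inl j⟩ => if i = j then 0 else 1
  | ⟨.inl i⟩, ⟨.inr k⟩ => if i < k then 2 else 1
  | ⟨.inr k⟩, ⟨.inl i⟩ => if i < k then 2 else 1
  | ⟨.inr k⟩, ⟨.inr m⟩ => if k = m then 0 else 1

theorem halfDist_self (x : HalfGraph) : halfDist x x = 0 := by
  rcases x with ⟨i | i⟩ <;> simp [halfDist]

theorem halfDist_comm (x y : HalfGraph) : halfDist x y = halfDist y x := by
  rcases x with ⟨i | i⟩ <;> rcases y with ⟨j | j⟩ <;> simp [halfDist, eq_comm]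

theorem one_le_halfDist {x y : HalfGraph} (h : x ≠ y) : 1 ≤ halfDist x y := by
  rcases x with ⟨i | i⟩ <;> rcases y with ⟨j | j⟩ <;> simp only [halfDist] <;>
    split_ifs <;> first | (subst i; exact absurd rfl h) | norm_num

theorem halfDist_le_two (x y : HalfGraph) : halfDist x y ≤ 2 := by
  rcases x with ⟨i | i⟩ <;> rcases y with ⟨j | j⟩ <;> simp only [halfDist] <;>
    split_ifs <;> norm_num

instance : MetricSpace HalfGraph where
  dist := halfDist
  dist_self := halfDist_self
  dist_comm := halfDist_comm
  dist_triangle x y z := by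
    by_cases hxy : x = y
    · rw [hxy, halfDist_self, zero_add]
    by_cases hyz : y = z
    · rw [hyz, halfDist_self, add_zero]
    linarith [one_le_halfDist hxy, one_le_halfDist hyz, halfDist_le_two x z]
  eq_of_dist_eq_zero {x y} h := by
    by_contra hxy
    have h1 := one_le_halfDist hxy
    have h2 : halfDist x y = 0 := h
    linarith

theorem one_le_dist {x y : HalfGraph} (h : x ≠ y) : 1 ≤ dist x y := one_le_halfDist h

theorem dist_le_two (x y : HalfGraph) : dist x y ≤ 2 := halfDist_le_two x y

theorem dist_l_r_of_lt {i k : ℕ} (h : i < k) : dist (l i) (r k) = 2 := if_pos h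

theorem dist_l_r_of_le {i k : ℕ} (h : k ≤ i) : dist (l i) (r k) = 1 := if_neg h.not_gt

theorem dist_l_l {i j : ℕ} (h : l i ≠ l j) : dist (l i) (l j) = 1 :=
  if_neg fun e => h (by rw [e])

theorem dist_r_r {i j : ℕ} (h : r i ≠ r j) : dist (r i) (r j) = 1 :=
  if_neg fun e => h (by rw [e])

/-- A 1-Lipschitz function separates only finitely many `l a` from some `r k` by more than
`1 + δ`. -/
theorem exists_bound (f : Lip0 (l 0)) (hf : ‖f‖ ≤ 1) {δ : ℝ} (hδ : 0 < δ) :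
    ∃ N : ℕ, ∀ a k, 1 + δ < |f (l a) - f (r k)| → a < N := by
  have hfd : ∀ x y, |f x - f y| ≤ dist x y := fun x y =>
    (Lip0.abs_sub_le f x y).trans (mul_le_of_le_one_left dist_nonneg hf)
  by_contra! hN
  choose a k hak hNa using hN
  have hb : ∀ m, f (l (a m)) ∈ Set.Icc (-2 : ℝ) 2 := fun m => by
    have h := (hfd (l (a m)) (l 0)).trans (dist_le_two _ _)
    rw [Lip0.map_base, sub_zero] at h
    exact abs_le.1 h
  obtain ⟨c, -, s, hs, hc⟩ := isCompact_Icc.tendsto_subseq hb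
  obtain ⟨p, hp⟩ := Metric.cauchySeq_iff'.1 hc.cauchySeq δ hδ
  -- Far enough along the subsequence, `l (a _)` is at distance `1` from the fixed point `r (k (s
  -- p))`, while its value differs from that at `l (a (s p))` by less than `δ`.
  have hq : k (s p) ≤ a (s (p + k (s p))) :=
    (Nat.le_add_left _ _).trans ((hs.id_le _).trans (hNa _))
  have h1 := hp (p + k (s p)) (Nat.le_add_right _ _)
  have h2 := hfd (l (a (s (p + k (s p))))) (r (k (s p)))
  rw [dist_l_r_of_le hq] at h2
  have h3 := hak (s p)
  rw [Real.dist_eq, Function.comp_apply, Function.comp_apply, abs_sub_comm] at h1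
  have h4 := abs_sub_le (f (l (a (s p)))) (f (l (a (s (p + k (s p)))))) (f (r (k (s p))))
  linarith

theorem functionLTP : FunctionLTP (l 0) := by
  intro μ hμ ε hε0 hε1 n f hf
  -- The threshold `1 + 2 * ε` suits the easy case: `(1 - ε) * (2 + 2 * ε) ≤ 2`. Beyond it, `x` and
  -- `y` lie in different copies and the `inl` point has index below `K`, hence is at distance `2`
  -- from both `r p` and `r (p + 1)`.
  choose N hN using fun i => exists_bound (f i) (hf i) (show 0 < 2 * ε by linarith)
  obtain ⟨K, hK⟩ : ∃ K, ∀ i, N i ≤ K :=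
    ⟨∑ i, N i, fun i => Finset.single_le_sum (fun _ _ => Nat.zero_le _) (Finset.mem_univ i)⟩
  obtain ⟨m, hm⟩ := μ.exists_gammaSet_lt hμ (fun j => {r (K + 2 * j), r (K + 2 * j + 1)})
    (fun j j' hj => by
      rw [Set.disjoint_left]
      rintro x (rfl | rfl) (h | h) <;>
        (simp only [r, HalfGraph.mk.injEq, Sum.inr.injEq, Set.mem_singleton_iff] at h; omega))
    hε0
  set p := K + 2 * m
  have hpq : r p ≠ r (p + 1) := by simp [r]
  refine ⟨_, r p, r (p + 1), hm, by simp, by simp, hpq, fun x y hx hy i => ?_⟩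
  simp only [Set.mem_insert_iff, Set.mem_singleton_iff, not_or] at hx hy
  rw [dist_r_r hpq]
  have hd1 := one_le_dist hx.1
  have hd2 := one_le_dist hy.2
  by_cases hsmall : f i x - f i y ≤ 1 + 2 * ε
  · nlinarith [mul_le_mul_of_nonneg_left hsmall (show 0 ≤ 1 - ε by linarith)]
  rw [not_le] at hsmall
  have h3 : 3 ≤ dist x (r p) + dist y (r (p + 1)) := by
    rcases x with ⟨a | a⟩ <;> rcases y with ⟨b | b⟩
    · have h := Lip0.sub_le_dist (hf i) (l a) (l b)
      by_cases hab : a = b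
      · subst hab; linarith
      · rw [dist_l_l (by simpa [l] using hab)] at h; linarith
    · have h := (hN i a b (hsmall.trans_le (le_abs_self _))).trans_le (hK i)
      rw [dist_l_r_of_lt (show a < p by omega)]
      linarith
    · have h := (hN i b a ((abs_sub_comm (f i (l b)) _).symm ▸
        hsmall.trans_le (le_abs_self _))).trans_le (hK i)
      rw [dist_l_r_of_lt (show b < p + 1 by omega)]
      linarith
    · have h := Lip0.sub_le_dist (hf i) (r a) (r b)
      by_cases hab : a = b
      · subst hab; linarith
      · rw [dist_r_r (by simpa [r] using hab)] at h; linarith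
  have h4 := (Lip0.sub_le_dist (hf i) x y).trans (dist_le_two x y)
  nlinarith

/-- Otherwise some `x`, `y` off `A` at distance `2` have `dist x u = dist y v = 1`, contradicting
`(9 / 10) * 3 > 2`. The pair `l 0`, `r 1` works unless `u` and `v` are both in the second copy; then
points far out are used. -/
theorem large_of_le (A : Set HalfGraph) (u v : HalfGraph) (hu : u ∈ A) (hv : v ∈ A) (huv : u ≠ v)
    (h : ∀ x y : HalfGraph, x ∉ A → y ∉ A →
      (1 - 1 / 10 : ℝ) * (dist x y + dist u v) ≤ dist x u + dist y v) :
    l 0 ∈ A ∨ r 1 ∈ A ∨ (∃ n, ∀ i ≥ n, l i ∈ A) ∨ ∃ n, ∀ k ≥ n, r k ∈ A := by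
  by_contra! hA
  obtain ⟨h0, h1, hl, hr⟩ := hA
  have huv1 := one_le_dist huv
  have hne : ∀ {x z : HalfGraph}, x ∉ A → z ∈ A → x ≠ z := fun hx hz e => hx (e ▸ hz)
  have h01 : dist (l 0) (r 1) = 2 := dist_l_r_of_lt one_pos
  have h10 : dist (r 1) (l 0) = 2 := by rw [dist_comm, h01]
  rcases u with ⟨i | i⟩ <;> rcases v with ⟨j | j⟩
  · have hj : 1 ≤ j := Nat.one_le_iff_ne_zero.2 fun e => h0 (e ▸ hv)
    have := h (l 0) (r 1) h0 h1
    rw [h01, dist_l_l (hne h0 hu), dist_comm (r 1), dist_l_r_of_le hj] at this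
    linarith
  · have := h (l 0) (r 1) h0 h1
    rw [h01, dist_l_l (hne h0 hu), dist_r_r (hne h1 hv)] at this
    linarith
  · have := h (r 1) (l 0) h1 h0
    rw [h10, dist_l_l (hne h0 hv), dist_r_r (hne h1 hu)] at this
    linarith
  · obtain ⟨a, ha, haA⟩ := hl i
    obtain ⟨k, hk, hkA⟩ := hr (a + 1)
    have := h (l a) (r k) haA hkA
    rw [dist_l_r_of_lt (show a < k by omega), dist_l_r_of_le ha, dist_r_r (hne hkA hv)] at this
    linarith

theorem not_seqLTP : ¬ SeqLTP HalfGraph := by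
  intro hM
  obtain ⟨A, u, v, hA, huv, h⟩ := hM (1 / 10) (by norm_num)
  have hlarge := fun m =>
    large_of_le (A m) (u m) (v m) (huv m).1 (huv m).2.1 (huv m).2.2 (h m)
  have hP : ∀ m, ∃ t : Fin 4, (t = 0 → l 0 ∈ A m) ∧ (t = 1 → r 1 ∈ A m) ∧
      (t = 2 → ∃ n, ∀ i ≥ n, l i ∈ A m) ∧ (t = 3 → ∃ n, ∀ k ≥ n, r k ∈ A m) := fun m => by
    rcases hlarge m with h | h | h | h
    · exact ⟨0, by simp [h]⟩
    · exact ⟨1, by simp [h]⟩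
    · exact ⟨2, by simpa using h⟩
    · exact ⟨3, by simpa using h⟩
  choose t ht0 ht1 ht2 ht3 using hP
  -- Two of the sets are large for the same one of the four reasons, and so they meet.
  obtain ⟨k, m, hkm, hteq⟩ := Finite.exists_ne_map_eq_of_infinite t
  have hd := Set.disjoint_left.1 (hA k m hkm)
  have hcases : t m = 0 ∨ t m = 1 ∨ t m = 2 ∨ t m = 3 := by
    generalize t m = s
    fin_cases s <;> simp
  rcases hcases with e | e | e | e
  · exact hd (ht0 k (hteq.trans e)) (ht0 m e)
  · exact hd (ht1 k (hteq.trans e)) (ht1 m e)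
  · obtain ⟨a, ha⟩ := ht2 k (hteq.trans e)
    obtain ⟨b, hb⟩ := ht2 m e
    exact hd (ha (max a b) (le_max_left _ _)) (hb (max a b) (le_max_right _ _))
  · obtain ⟨a, ha⟩ := ht3 k (hteq.trans e)
    obtain ⟨b, hb⟩ := ht3 m e
    exact hd (ha (max a b) (le_max_left _ _)) (hb (max a b) (le_max_right _ _))

end HalfGraph

theorem mainTheorem4 :
    (∀ (M : Type*) [MetricSpace M] (o : M), FunctionLTP o → StrongDiameterTwo (Lip0 o)) ∧
    (∀ (M : Type*) [MetricSpace M] (o : M), SeqLTP M → FunctionLTP o) ∧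
    (∃ (M : Type) (_ : MetricSpace M) (o : M), FunctionLTP o ∧ ¬ SeqLTP M) :=
  ⟨fun _ _ _ => strongDiameterTwo_of_functionLTP, fun _ _ o => functionLTP_of_seqLTP o,
    HalfGraph, inferInstance, HalfGraph.l 0, HalfGraph.functionLTP, HalfGraph.not_seqLTP⟩
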